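/- Fix a universe $\mathbb U$; schemes are $\mathbb U$-small and sheaves take values in $\mathbb U$-sets. For a scheme $X$, let $X_{\text{ét}}$ be the topos of sheaves of sets on the étale site $\text{Ét}_{/X}$ of $X$ (all étale $X$-schemes, with the étale topology), and let $X_{\text{fét}}$ be the topos of sheaves of sets on the full subcategory $\text{Ét}_{\mathrm f/X}\subset \text{Ét}_{/X}$ of finite étale $X$-schemes, equipped with the topology induced by the étale topology, i.e. the finest topology for which the inclusion is continuous. Let $\rho_X\colon X_{\text{ét}}\to X_{\text{fét}}$ be the morphism of topoi defined by the inclusion $\text{Ét}_{\mathrm f/X}\to\text{Ét}_{/X}$: the direct image $\rho_{X*}$ is the restriction of sheaves to $\text{Ét}_{\mathrm f/X}$, and the inverse image $\rho_X^*$ is its left adjoint. Let $X$ be a coherent (i.e. quasi-compact and quasi-separated) scheme with finitely many connected components. Then the adjunction morphism $\mathrm{id}\to\rho_{X*}\rho_X^*$ is an isomorphism of functors $X_{\text{fét}}\to X_{\text{fét}}$; in particular, the functor $\rho_X^*\colon X_{\text{fét}}\to X_{\text{ét}}$ is fully faithful. -/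

import Mathlib

open CategoryTheory Limits Opposite AlgebraicGeometry

universe u

noncomputable section

namespace FiniteEtaleTopos

/-! ### Smallness of a category of set-valued presheaves with bounded values -/

section Bounded

variable {E : Type u} [SmallCategory E]

/-- Presheaves of sets whose value at each object embeds into a prescribed set. -/
def boundedPresheaf (M : E → Type u) : ObjectProperty (Eᵒᵖ ⥤ Type u) :=
  fun F => ∀ c : E, ∃ f : F.obj (op c) → M c, Function.Injective f

/-- Codes for presheaves whose values are subsets of prescribed sets. -/
structure BoundedCode (M : E → Type u) : Type u where
  carrier : ∀ c : E, Set (M c)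
  map : ∀ {c d : E}, (c ⟶ d) → carrier d → carrier c
  map_id : ∀ {c : E} (x : carrier c), map (𝟙 c) x = x
  map_comp : ∀ {c d e : E} (f : c ⟶ d) (g : d ⟶ e) (x : carrier e),
    map (f ≫ g) x = map f (map g x)

/-- The presheaf described by a code. -/
def BoundedCode.toPresheaf {M : E → Type u} (D : BoundedCode M) : Eᵒᵖ ⥤ Type u where
  obj c := D.carrier c.unop
  map f := ↾(D.map f.unop)
  map_id c := by
    ext x
    exact congrArg Subtype.val (D.map_id x)
  map_comp f g := by
    ext x
    exact congrArg Subtype.val (D.map_comp g.unop f.unop x)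

instance (M : E → Type u) : ObjectProperty.EssentiallySmall.{u} (boundedPresheaf M) where
  exists_small_le' := by
    refine ⟨ObjectProperty.ofObj (BoundedCode.toPresheaf (M := M)), inferInstance, ?_⟩
    intro F hF
    choose j hj using hF
    let e (c : E) : F.obj (op c) ≃ Set.range (j c) := Equiv.ofInjective (j c) (hj c)
    let D : BoundedCode M :=
      { carrier := fun c => Set.range (j c)
        map := fun {c d} f x => e c (F.map f.op ((e d).symm x))
        map_id := fun x => by simp
        map_comp := fun f g x => by simp }
    refine ⟨D.toPresheaf, ObjectProperty.ofObj_apply _ D, ⟨?_⟩⟩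
    refine NatIso.ofComponents (fun c => (e c.unop).toIso) ?_
    intro c d f
    ext x
    have h : e d.unop (F.map f x) = e d.unop (F.map f ((e c.unop).symm (e c.unop x))) := by
      rw [Equiv.symm_apply_apply]
    exact h

end Bounded

variable (X : Scheme.{u})

/-! ### The finite étale site -/

/-- The étale `X`-schemes that are finite over `X`, i.e. the étale coverings of `X`. -/
def isFinite : ObjectProperty X.Etale := fun Y => IsFinite Y.hom

/-- The category of finite étale `X`-schemes, a full subcategory of the étale `X`-schemes. -/
abbrev FEt : Type (u + 1) := (isFinite X).FullSubcategory

/-- The inclusion of the finite étale `X`-schemes into the étale `X`-schemes. -/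
abbrev incl : FEt X ⥤ X.Etale := (isFinite X).ι

/-- The topology on finite étale `X`-schemes induced by the étale topology: the finest topology
for which the inclusion into the étale site is continuous. -/
def fetTopology : GrothendieckTopology (FEt X) :=
  (incl X).inducedTopology X.smallEtaleTopology

instance : (incl X).IsContinuous (fetTopology X) X.smallEtaleTopology :=
  inferInstanceAs ((incl X).IsContinuous ((incl X).inducedTopology _) _)

/-- The étale topos of `X`. -/
abbrev EtTopos : Type (u + 1) := Sheaf X.smallEtaleTopology (Type u)

/-- The finite étale topos of `X`. -/
abbrev FEtTopos : Type (u + 1) := Sheaf (fetTopology X) (Type u)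

/-! ### Essential smallness of the finite étale site -/

instance : X.smallEtaleTopology.Subcanonical := by
  have : (Scheme.etaleTopology.{u}).Subcanonical :=
    .of_le Scheme.etaleTopology_le_proetaleTopology
  have : RepresentablyFlat (Scheme.Etale.forget X) := flat_of_preservesFiniteLimits _
  have : (Scheme.Etale.forget X).LocallyCoverDense (Scheme.etaleTopology.over X) :=
    have i₁ : MorphismProperty.IsStableUnderBaseChange @Etale.{u} := inferInstance
    have i₂ : MorphismProperty.IsMultiplicative @Etale.{u} := inferInstance
    have i₃ : MorphismProperty.RespectsIso @Etale.{u} := i₁.respectsIso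
    @Scheme.locallyCoverDense_of_le @Etale @Etale X i₁ i₂ i₃ i₂.toIsStableUnderComposition le_rfl
  have : (Scheme.Etale.forget X).IsContinuous X.smallEtaleTopology
      (Scheme.etaleTopology.over X) := by
    rw [Functor.isContinuous_iff_coverPreserving]
    exact Functor.coverPreserving_restrictedTopology (Scheme.Etale.forget X) _
  exact GrothendieckTopology.subcanonical_of_full_of_faithful
    (Scheme.Etale.forget X) _ (Scheme.etaleTopology.over X)

/-- Sections of a finite scheme over an affine scheme `Spec R` embed into a set which depends only
on `R`: a section is determined by its values on finitely many generators. -/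
lemma exists_injective_sections {Y : Scheme.{u}} (f : Y ⟶ X) [IsFinite f] (R : CommRingCat.{u})
    (g : Spec R ⟶ X) :
    ∃ j : {s : Spec R ⟶ Y // s ≫ f = g} → (ℕ → Γ(Spec R, ⊤)), Function.Injective j := by
  let p := pullback.snd f g
  have : IsAffine (pullback f g) := isAffine_of_isAffineHom p
  have hp : p.appTop.hom.Finite := p.finite_appTop
  algebraize [p.appTop.hom]
  obtain ⟨n, b, hb⟩ := Module.Finite.exists_fin (R := Γ(Spec R, ⊤)) (M := Γ(pullback f g, ⊤))
  let l (s : {s : Spec R ⟶ Y // s ≫ f = g}) : Spec R ⟶ pullback f g :=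
    pullback.lift s.1 (𝟙 _) (by simp [s.2])
  have hl (s) : l s ≫ p = 𝟙 _ := pullback.lift_snd _ _ _
  have hl' (s) (r : Γ(Spec R, ⊤)) : (l s).appTop.hom (p.appTop.hom r) = r := by
    have := congrArg (fun q => q.appTop.hom r) (hl s)
    simpa [Scheme.Hom.appTop] using! this
  refine ⟨fun s i => if h : i < n then (l s).appTop.hom (b ⟨i, h⟩) else 0, ?_⟩
  intro s t hst
  have key : (l s).appTop = (l t).appTop := by
    ext x
    have hx : x ∈ Submodule.span Γ(Spec R, ⊤) (Set.range b) := hb ▸ Submodule.mem_top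
    change (l s).appTop.hom x = (l t).appTop.hom x
    induction hx using Submodule.span_induction with
    | mem x hx =>
      obtain ⟨i, rfl⟩ := hx
      simpa using congrFun hst i
    | zero => simp
    | add x y _ _ hx hy => simp only [map_add, hx, hy]
    | smul r x _ hx =>
      rw [Algebra.smul_def, map_mul, map_mul, hx, RingHom.algebraMap_toAlgebra, hl', hl']
  have h2 : l s = l t := ext_of_isAffine key
  apply Subtype.ext
  calc s.1 = l s ≫ pullback.fst f g := (pullback.lift_fst _ _ _).symm
    _ = l t ≫ pullback.fst f g := by rw [h2]
    _ = t.1 := pullback.lift_fst _ _ _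

/-- The presheaf on (a small model of) the affine étale site of `X` represented by a finite
étale `X`-scheme. -/
def fetRestrict : FEt X ⥤ ((SmallModel.{u} X.AffineEtale)ᵒᵖ ⥤ Type u) :=
  incl X ⋙ X.smallEtaleTopology.yoneda ⋙
    (Scheme.AffineEtale.Spec X).sheafPushforwardContinuous (Type u)
      (Scheme.AffineEtale.topology X) X.smallEtaleTopology ⋙
    sheafToPresheaf _ _ ⋙
    (equivSmallModel.{u} X.AffineEtale).op.congrLeft.functor

instance : (fetRestrict X).Full := by
  dsimp only [fetRestrict]
  infer_instance

instance : (fetRestrict X).Faithful := by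
  dsimp only [fetRestrict]
  infer_instance

instance : EssentiallySmall.{u} (FEt X) := by
  let A (c : SmallModel.{u} X.AffineEtale) : X.AffineEtale :=
    (equivSmallModel.{u} X.AffineEtale).inverse.obj c
  let M (c : SmallModel.{u} X.AffineEtale) : Type u :=
    ℕ → Γ(((Scheme.AffineEtale.Spec X).obj (A c)).left, ⊤)
  have hM (Y : FEt X) : boundedPresheaf M ((fetRestrict X).obj Y) := by
    intro c
    have : IsFinite Y.obj.hom := Y.property
    obtain ⟨j, hj⟩ := exists_injective_sections X Y.obj.hom (A c).left.unop
      ((Scheme.AffineEtale.Spec X).obj (A c)).hom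
    let i (s : (Scheme.AffineEtale.Spec X).obj (A c) ⟶ Y.obj) :
        {s : Spec (A c).left.unop ⟶ Y.obj.left //
          s ≫ Y.obj.hom = ((Scheme.AffineEtale.Spec X).obj (A c)).hom} :=
      ⟨s.left, MorphismProperty.Over.w s⟩
    have hi : Function.Injective i := by
      intro s t hst
      exact MorphismProperty.Over.Hom.ext (congrArg Subtype.val hst)
    exact ⟨fun s => j (i s), hj.comp hi⟩
  exact essentiallySmall_of_fully_faithful ((boundedPresheaf M).lift (fetRestrict X) hM)

/-! ### The morphism of topoi -/

instance : ((incl X).sheafPushforwardContinuous (Type u) (fetTopology X)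
    X.smallEtaleTopology).IsRightAdjoint := by
  have (F : (FEt X)ᵒᵖ ⥤ Type u) : (incl X).op.HasLeftKanExtension F := by
    have (Y : (X.Etale)ᵒᵖ) : HasColimitsOfShape (CostructuredArrow (incl X).op Y) (Type u) :=
      hasColimitsOfShape_of_essentiallySmall.{u} _ _
    infer_instance
  infer_instance

/-- The direct image `ρ_{X*}`: restriction of étale sheaves to finite étale `X`-schemes. -/
def rhoPushforward : EtTopos X ⥤ FEtTopos X :=
  (incl X).sheafPushforwardContinuous (Type u) (fetTopology X) X.smallEtaleTopology

/-- The inverse image `ρ_X^*`, the left adjoint of `ρ_{X*}`. -/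
def rhoPullback : FEtTopos X ⥤ EtTopos X :=
  (incl X).sheafPullback (Type u) (fetTopology X) X.smallEtaleTopology

/-- The adjunction between `ρ_X^*` and `ρ_{X*}`. -/
def rhoAdjunction : rhoPullback X ⊣ rhoPushforward X :=
  (incl X).sheafAdjunctionContinuous (Type u) (fetTopology X) X.smallEtaleTopology

end FiniteEtaleTopos

end

universe w v₁ v₂ u₁ u₂

noncomputable section

/-! ### Covering sieves of an induced topology -/

namespace CategoryTheory

variable {C : Type u₁} [Category.{v₁} C] {D : Type u₂} [Category.{v₂} D]

/-! The inverse image of `F` is the sheafification `G` of its left Kan extension. Finite étale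
schemes have finite limits, preserved by the inclusion, so the Kan extension is a filtered colimit.
Hence sections of `G` come étale-locally from sections of `F`, and agree only where the latter agree
locally (`isLocallyInverseImage_toInverseImage`).

The crux is that agreement loci are clopen. On a finite étale `Z`, the locus for two sections of `F`
is a union of images of finite étale maps, each clopen; `Z` has finitely many clopen subsets because
`X` has finitely many components, so the union is clopen. This passes to sections of `G`
étale-locally.

Injectivity of `F(Z) → G(Z)` is separatedness of `F`. For surjectivity, let `t` in `G(Z)` agree with
the pullback of some `s'` in `F(Z')` on an étale neighbourhood `V` of a point. The locus in `Z × Z'`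
where `t` and `s'` agree is clopen, hence finite étale over `X`, and contains the image of `V`. So
`t` comes from `F` finite-étale-locally, and injectivity lets these sections glue. -/

lemma Sieve.pullback_functorPushforward_le [HasPullbacks C] (F : C ⥤ D)
    [PreservesLimitsOfShape WalkingCospan F] {Y Z : C} (f : Y ⟶ Z) (S : Sieve Z) :
    (S.functorPushforward F).pullback (F.map f) ≤ (S.pullback f).functorPushforward F := by
  rintro V h ⟨W, g, k, hg, hk⟩
  have sq := (IsPullback.of_hasPullback f g).map F
  refine ⟨Limits.pullback f g, pullback.fst f g, sq.lift h k hk, ?_, (sq.lift_fst _ _ _).symm⟩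
  change S (pullback.fst f g ≫ f)
  rw [pullback.condition]
  exact S.downward_closed hg _

lemma Presieve.isSheafFor_op_comp_of_functorPushforward_mem {F : C ⥤ D}
    {K : GrothendieckTopology D} (hF : CompatiblePreserving.{w} K F) (G : Sheaf K (Type w))
    {Z : C} {S : Sieve Z} (hS : S.functorPushforward F ∈ K (F.obj Z)) :
    Presieve.IsSheafFor (F.op ⋙ G.obj) S.arrows := by
  intro x hx
  have hG := (isSheaf_iff_isSheaf_of_type _ _).1 G.2
  apply existsUnique_of_exists_of_unique
  · exact ⟨(hG _ hS).amalgamate (x.functorPushforward F) (hx.functorPushforward hF),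
      fun V f hf => ((hG _ hS).isAmalgamation (hx.functorPushforward hF) (F.map f) _).trans
        (hF.apply_map _ hx hf)⟩
  · intro y₁ y₂ hy₁ hy₂
    apply (hG.isSeparated _ hS).ext
    rintro Y _ ⟨Z, g, h, hg, rfl⟩
    simpa using! congrArg _ ((hy₁ g hg).trans (hy₂ g hg).symm)

/-- Membership in the finest topology requires the sheaf condition for every pullback of `S`; since
`F` preserves pullbacks, these also have covering image. -/
lemma Functor.mem_inducedTopology_of_functorPushforward_mem [HasFiniteLimits C] (F : C ⥤ D)
    [PreservesFiniteLimits F] (K : GrothendieckTopology D) {Z : C} {S : Sieve Z}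
    (hS : S.functorPushforward F ∈ K (F.obj Z)) : S ∈ F.inducedTopology K Z := by
  have : RepresentablyFlat F := flat_of_preservesFiniteLimits F
  apply Sheaf.mem_finestTopology_of_forall_isSheafFor
  rintro _ ⟨G, rfl⟩ Y f
  exact Presieve.isSheafFor_op_comp_of_functorPushforward_mem (compatiblePreservingOfFlat K F) G
    (K.superset_covering (Sieve.pullback_functorPushforward_le F f S) (K.pullback_stable _ hS))

end CategoryTheory

/-! ### Finite limits of finite étale schemes -/

namespace FiniteEtaleTopos

variable (X : Scheme.{u})

/-- The underlying scheme of an étale `X`-scheme. -/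
abbrev toScheme : X.Etale ⥤ Scheme.{u} := Scheme.Etale.forget X ⋙ Over.forget X

/-- The structure morphism of an étale `X`-scheme. -/
abbrev structureMap {X : Scheme.{u}} (Y : X.Etale) : (toScheme X).obj Y ⟶ X := Y.hom

variable {X} in
lemma toScheme_map_structureMap {Y Z : X.Etale} (f : Y ⟶ Z) :
    (toScheme X).map f ≫ structureMap Z = structureMap Y :=
  MorphismProperty.Over.w f

instance (Y : FEt X) : IsFinite (structureMap Y.obj) := Y.property

instance (Y : X.Etale) : Etale (structureMap Y) := Y.prop

instance {Y Z : X.Etale} (f : Y ⟶ Z) : Etale ((toScheme X).map f) := by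
  have : Etale ((toScheme X).map f ≫ structureMap Z) := by
    rw [toScheme_map_structureMap]; infer_instance
  exact Etale.of_comp _ (structureMap Z)

lemma isFinite_toScheme_map {Y Z : X.Etale} (f : Y ⟶ Z) (hY : isFinite X Y)
    (hZ : isFinite X Z) : IsFinite ((toScheme X).map f) := by
  have : IsFinite (structureMap Z) := hZ
  have : IsFinite ((toScheme X).map f ≫ structureMap Z) := by
    rw [toScheme_map_structureMap]; exact hY
  exact IsFinite.of_comp _ (structureMap Z)

instance : (isFinite X).IsClosedUnderLimitsOfShape (Discrete PEmpty.{1}) where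
  limitsOfShape_le := by
    rintro Y p
    have t : IsTerminal Y := ((ObjectProperty.limitsOfShape_isEmpty_iff _ _ _).mp p).some
    have i : MorphismProperty.IsMultiplicative @Etale.{u} := inferInstance
    let e : Y ≅ Scheme.Etale.mk (𝟙 X) := t.uniqueUpToIso (@MorphismProperty.Over.mkIdTerminal _ _ @Etale.{u} X
      i.toContainsIdentities)
    have h : (toScheme X).map e.hom = structureMap Y :=
      (Category.comp_id _).symm.trans (MorphismProperty.Over.w e.hom)
    have : IsIso ((toScheme X).map e.hom) := inferInstance
    have : IsIso (structureMap Y) := h ▸ this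
    exact (inferInstance : IsFinite (structureMap Y))

instance : (isFinite X).IsClosedUnderLimitsOfShape WalkingCospan where
  limitsOfShape_le := by
    rintro Y ⟨p, hp⟩
    have sq := IsPullback.of_isLimit_cone (isLimitOfPreserves (toScheme X) p.isLimit)
    have h₁ : IsFinite ((toScheme X).map (p.diag.map WalkingCospan.Hom.inr)) :=
      isFinite_toScheme_map X _ (hp .right) (hp .one)
    have h₂ : IsFinite (structureMap (p.diag.obj .left)) := hp .left
    -- This projection is a base change of the right leg of the cospan, a map of finite `X`-schemes.
    have h₃ : IsFinite ((toScheme X).map (p.π.app .left)) :=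
      MorphismProperty.of_isPullback (P := @IsFinite) sq.flip h₁
    have h₄ := toScheme_map_structureMap (p.π.app .left)
    change IsFinite (structureMap Y)
    rw [show structureMap Y = _ from h₄.symm]
    exact inferInstanceAs
      (IsFinite ((toScheme X).map (p.π.app .left) ≫ structureMap (p.diag.obj .left)))

instance : HasFiniteLimits (FEt X) := hasFiniteLimits_of_hasTerminal_and_pullbacks

instance : PreservesFiniteLimits (incl X) :=
  preservesFiniteLimits_of_preservesTerminal_and_pullbacks _

end FiniteEtaleTopos

/-! ### Clopen subsets -/

/-- If a finite set meets every nonempty clopen subset, there are finitely many clopen subsets. -/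
lemma finite_isClopen_of_finite_meeting {T : Type*} [TopologicalSpace T] {S : Set T}
    (hS : S.Finite) (h : ∀ A : Set T, IsClopen A → A.Nonempty → (A ∩ S).Nonempty) :
    {A : Set T | IsClopen A}.Finite := by
  refine Set.Finite.of_finite_image (f := fun A => A ∩ S)
    (hS.finite_subsets.subset ?_) ?_
  · rintro _ ⟨A, -, rfl⟩
    exact Set.inter_subset_right
  · have key {A B : Set T} (hA : IsClopen A) (hB : IsClopen B) (hAB : A ∩ S = B ∩ S) : A ⊆ B := by
      by_contra hne
      obtain ⟨x, hx⟩ := h (A \ B) (hA.diff hB) (Set.sdiff_nonempty.2 hne)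
      exact hx.1.2 ((hAB ▸ ⟨hx.1.1, hx.2⟩ : x ∈ B ∩ S).1)
    intro A hA B hB hAB
    exact (key hA hB hAB).antisymm (key hB hA hAB.symm)

/-- A space with an open and closed map with finite fibres to a space with finitely many connected
components has finitely many clopen subsets. -/
lemma finite_isClopen_of_isOpenMap_of_isClosedMap {T B : Type*} [TopologicalSpace T]
    [TopologicalSpace B] [Finite (_root_.ConnectedComponents B)] {f : T → B} (ho : IsOpenMap f)
    (hc : IsClosedMap f) (hf : ∀ b, (f ⁻¹' {b}).Finite) :
    {A : Set T | IsClopen A}.Finite := by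
  -- The finite set consists of the fibres over one chosen point in each component; the image of a
  -- clopen set is clopen, so it contains such a point as soon as it is nonempty.
  refine finite_isClopen_of_finite_meeting
    (S := f ⁻¹' Set.range (Quotient.out : _root_.ConnectedComponents B → B)) ?_ ?_
  · have : Finite (_root_.Quotient (connectedComponentSetoid B)) :=
      inferInstanceAs (Finite (_root_.ConnectedComponents B))
    exact (Set.finite_range _).preimage' fun b _ => hf b
  · rintro A hA ⟨a, ha⟩
    have hfA : IsClopen (f '' A) := ⟨hc A hA.1, ho A hA.2⟩
    let b : B := Quotient.out (_root_.ConnectedComponents.mk (f a))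
    have hb : (b : _root_.ConnectedComponents B) = f a := Quotient.out_eq _
    have hb' : b ∈ f '' A :=
      hfA.connectedComponent_subset (Set.mem_image_of_mem f ha)
        (_root_.ConnectedComponents.coe_eq_coe'.1 hb)
    obtain ⟨x, hx, hxb⟩ := hb'
    exact ⟨x, hx, _, hxb.symm⟩

/-! ### Clopen subschemes and coverings as surjective families -/

namespace FiniteEtaleTopos

variable {X : Scheme.{u}}

lemma exists_preimage_of_isPullback {P A B Z : X.Etale} {p : P ⟶ A} {q : P ⟶ B} {f : A ⟶ Z}
    {g : B ⟶ Z} (sq : IsPullback p q f g) {a : (toScheme X).obj A} {b : (toScheme X).obj B}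
    (h : (toScheme X).map f a = (toScheme X).map g b) :
    ∃ c : (toScheme X).obj P, (toScheme X).map p c = a ∧ (toScheme X).map q c = b := by
  have sq' := sq.map (toScheme X)
  obtain ⟨c, hc₁, hc₂⟩ := Scheme.Pullback.exists_preimage_pullback a b h
  refine ⟨sq'.isoPullback.inv c, ?_, ?_⟩
  · rw [← Scheme.Hom.comp_apply, sq'.isoPullback_inv_fst, hc₁]
  · rw [← Scheme.Hom.comp_apply, sq'.isoPullback_inv_snd, hc₂]

lemma isOpenMap_toScheme_map {Y Z : X.Etale} (f : Y ⟶ Z) : IsOpenMap ((toScheme X).map f) :=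
  ((toScheme X).map f).isOpenMap

lemma isClopen_range {Y Z : FEt X} (f : Y ⟶ Z) :
    IsClopen (Set.range ((toScheme X).map ((incl X).map f))) := by
  have := isFinite_toScheme_map X ((incl X).map f) Y.property Z.property
  exact ⟨((toScheme X).map ((incl X).map f)).isClosedMap.isClosed_range,
    (isOpenMap_toScheme_map _).isOpen_range⟩

lemma finite_isClopen [Finite (_root_.ConnectedComponents X)] (Z : FEt X) :
    {A : Set ((toScheme X).obj Z.obj) | IsClopen A}.Finite :=
  finite_isClopen_of_isOpenMap_of_isClosedMap (f := structureMap Z.obj)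
    (structureMap Z.obj).isOpenMap (structureMap Z.obj).isClosedMap
    (structureMap Z.obj).finite_preimage_singleton

lemma exists_range_eq_of_isClopen {Z : FEt X} {A : Set ((toScheme X).obj Z.obj)}
    (hA : IsClopen A) :
    ∃ (Y : FEt X) (f : Y ⟶ Z), Set.range ((toScheme X).map ((incl X).map f)) = A := by
  let V : ((toScheme X).obj Z.obj).Opens := ⟨A, hA.2⟩
  have hV : IsClosedImmersion V.ι := by
    refine .of_isPreimmersion _ ?_
    rw [Scheme.Opens.range_ι]
    exact hA.1
  let Y : X.Etale := Scheme.Etale.mk (V.ι ≫ structureMap Z.obj)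
  have hY : isFinite X Y := inferInstanceAs (IsFinite (V.ι ≫ structureMap Z.obj))
  let f : Y ⟶ Z.obj := MorphismProperty.Over.homMk V.ι rfl
  refine ⟨⟨Y, hY⟩, ⟨f⟩, ?_⟩
  exact Scheme.Opens.range_ι V

lemma ofArrows_mem_fetTopology {Z : FEt X} {ι : Type*} {Y : ι → FEt X} (f : ∀ i, Y i ⟶ Z)
    (h : ∀ z, ∃ i, z ∈ Set.range ((toScheme X).map ((incl X).map (f i)))) :
    Sieve.ofArrows _ f ∈ fetTopology X Z := by
  apply Functor.mem_inducedTopology_of_functorPushforward_mem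
  rw [Sieve.ofArrows, ← Sieve.generate_map_eq_functorPushforward, Presieve.map_ofArrows]
  refine (Scheme.ofArrows_mem_smallEtaleTopology_iff _).2 ?_
  exact Set.eq_univ_of_forall fun z => Set.mem_iUnion.2 (h z)

lemma ofArrows_mem_smallEtaleTopology {Z : X.Etale} {ι : Type*} {Y : ι → X.Etale}
    (f : ∀ i, Y i ⟶ Z) (h : ∀ z, ∃ i, z ∈ Set.range ((toScheme X).map (f i))) :
    Sieve.ofArrows _ f ∈ X.smallEtaleTopology Z :=
  (Scheme.ofArrows_mem_smallEtaleTopology_iff _).2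
    (Set.eq_univ_of_forall fun z => Set.mem_iUnion.2 (h z))

lemma exists_mem_range_of_mem_smallEtaleTopology {Z : X.Etale} {S : Sieve Z}
    (hS : S ∈ X.smallEtaleTopology Z) (z : (toScheme X).obj Z) :
    ∃ (Y : X.Etale) (f : Y ⟶ Z), S f ∧ z ∈ Set.range ((toScheme X).map f) := by
  obtain ⟨ι, Y, f, rfl⟩ := S.exists_eq_ofArrows
  obtain ⟨i, hi⟩ := Set.mem_iUnion.1
    (((Scheme.ofArrows_mem_smallEtaleTopology_iff f).1 hS).ge (Set.mem_univ z))
  exact ⟨Y i, f i, Sieve.ofArrows_mk _ _ i, hi⟩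

end FiniteEtaleTopos

/-! ### Agreement loci and the comparison of sections -/

namespace FiniteEtaleTopos

variable {X : Scheme.{u}} {F : (FEt X)ᵒᵖ ⥤ Type u} {G : X.Etaleᵒᵖ ⥤ Type u}

/-- The section over `U` obtained from a section of `F` over `Z` along `h : U ⟶ Z`. -/
def pull (η : F ⟶ (incl X).op ⋙ G) {U : X.Etale} {Z : FEt X} (h : U ⟶ Z.obj)
    (s : F.obj (op Z)) : G.obj (op U) :=
  G.map h.op (η.app (op Z) s)

lemma map_pull (η : F ⟶ (incl X).op ⋙ G) {U V : X.Etale} {Z : FEt X} (q : V ⟶ U)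
    (h : U ⟶ Z.obj) (s : F.obj (op Z)) : G.map q.op (pull η h s) = pull η (q ≫ h) s := by
  simp [pull]

lemma pull_map (η : F ⟶ (incl X).op ⋙ G) {U : X.Etale} {Y Z : FEt X} (h : U ⟶ Y.obj)
    (g : Y ⟶ Z) (s : F.obj (op Z)) :
    pull η h (F.map g.op s) = pull η (h ≫ (incl X).map g) s := by
  have := ConcreteCategory.congr_hom (η.naturality g.op) s
  simp only [pull]
  erw [this]
  simp

/-- A presheaf on the étale site is locally an inverse image of a presheaf on the finite étale
site if its sections come locally from the latter, and two of these agree only if they do so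
locally for the finite étale topology. -/
structure IsLocallyInverseImage (η : F ⟶ (incl X).op ⋙ G) : Prop where
  exists_eq_pull {U : X.Etale} (t : G.obj (op U)) (x : (toScheme X).obj U) :
    ∃ (V : X.Etale) (q : V ⟶ U) (Z : FEt X) (h : V ⟶ Z.obj) (s : F.obj (op Z)),
      x ∈ Set.range ((toScheme X).map q) ∧ G.map q.op t = pull η h s
  exists_map_eq {U : X.Etale} {Z : FEt X} (h : U ⟶ Z.obj) (s s' : F.obj (op Z))
    (hs : pull η h s = pull η h s') (x : (toScheme X).obj U) :
    ∃ (W : FEt X) (g : W ⟶ Z),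
      (toScheme X).map h x ∈ Set.range ((toScheme X).map ((incl X).map g)) ∧
        F.map g.op s = F.map g.op s'

lemma toScheme_map_comp_apply {U V W : X.Etale} (p : U ⟶ V) (q : V ⟶ W)
    (x : (toScheme X).obj U) :
    (toScheme X).map (p ≫ q) x = (toScheme X).map q ((toScheme X).map p x) := by
  rw [Functor.map_comp, Scheme.Hom.comp_apply]

lemma exists_lift_of_finiteEtale {U : X.Etale} {Z₁ Z₂ : FEt X} (h₁ : U ⟶ Z₁.obj)
    (h₂ : U ⟶ Z₂.obj) :
    ∃ (Z : FEt X) (p₁ : Z ⟶ Z₁) (p₂ : Z ⟶ Z₂) (h : U ⟶ Z.obj),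
      h ≫ (incl X).map p₁ = h₁ ∧ h ≫ (incl X).map p₂ = h₂ := by
  obtain ⟨h, hh₁, hh₂⟩ := BinaryFan.IsLimit.lift'
    (isLimitOfHasBinaryProductOfPreservesLimit (incl X) Z₁ Z₂) h₁ h₂
  exact ⟨Z₁ ⨯ Z₂, prod.fst, prod.snd, h, hh₁, hh₂⟩

/-- The locus in a finite étale `X`-scheme where two sections agree. -/
def eqLocus {Z : FEt X} (s s' : F.obj (op Z)) : Set ((toScheme X).obj Z.obj) :=
  {z | ∃ (W : FEt X) (g : W ⟶ Z), z ∈ Set.range ((toScheme X).map ((incl X).map g)) ∧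
    F.map g.op s = F.map g.op s'}

/-- Closedness is where finiteness enters: only finitely many distinct images occur in the union. -/
lemma isClopen_eqLocus [Finite (_root_.ConnectedComponents X)] {Z : FEt X}
    (s s' : F.obj (op Z)) : IsClopen (eqLocus s s') := by
  let R : Set (Set ((toScheme X).obj Z.obj)) :=
    {A | ∃ (W : FEt X) (g : W ⟶ Z), Set.range ((toScheme X).map ((incl X).map g)) = A ∧
      F.map g.op s = F.map g.op s'}
  have hR : ∀ A ∈ R, IsClopen A := by
    rintro _ ⟨W, g, rfl, -⟩
    exact isClopen_range g
  have : eqLocus s s' = ⋃ A ∈ R, A := by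
    ext z
    simp only [eqLocus, R, Set.mem_ofPred_eq, Set.mem_iUnion]
    constructor
    · rintro ⟨W, g, hz, h⟩
      exact ⟨_, ⟨W, g, rfl, h⟩, hz⟩
    · rintro ⟨_, ⟨W, g, rfl, h⟩, hz⟩
      exact ⟨W, g, hz, h⟩
  rw [this]
  exact ((finite_isClopen Z).subset hR).isClopen_biUnion hR

/-- The locus in an étale `X`-scheme where two sections agree. -/
def etaleEqLocus {U : X.Etale} (t t' : G.obj (op U)) : Set ((toScheme X).obj U) :=
  {x | ∃ (V : X.Etale) (q : V ⟶ U), x ∈ Set.range ((toScheme X).map q) ∧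
    G.map q.op t = G.map q.op t'}

lemma isOpen_etaleEqLocus {U : X.Etale} (t t' : G.obj (op U)) : IsOpen (etaleEqLocus t t') := by
  rw [isOpen_iff_forall_mem_open]
  rintro x ⟨V, q, hx, h⟩
  exact ⟨_, fun y hy => ⟨V, q, hy, h⟩, (isOpenMap_toScheme_map q).isOpen_range, hx⟩

lemma preimage_etaleEqLocus {U V : X.Etale} (q : V ⟶ U) (t t' : G.obj (op U)) :
    (toScheme X).map q ⁻¹' etaleEqLocus t t' = etaleEqLocus (G.map q.op t) (G.map q.op t') := by
  ext x
  constructor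
  · rintro ⟨W, p, ⟨w, hw⟩, h⟩
    obtain ⟨y, hy₁, -⟩ := exists_preimage_of_isPullback (IsPullback.of_hasPullback q p) hw.symm
    refine ⟨_, pullback.fst q p, ⟨y, hy₁⟩, ?_⟩
    simp only [← Functor.map_comp_apply, ← op_comp, pullback.condition]
    simp [h]
  · rintro ⟨W, p, ⟨w, rfl⟩, h⟩
    refine ⟨W, p ≫ q, ⟨w, toScheme_map_comp_apply _ _ _⟩, ?_⟩
    simpa using h

lemma IsLocallyInverseImage.etaleEqLocus_pull {η : F ⟶ (incl X).op ⋙ G}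
    (hη : IsLocallyInverseImage η) {U : X.Etale} {Z : FEt X} (h : U ⟶ Z.obj)
    (s s' : F.obj (op Z)) :
    etaleEqLocus (pull η h s) (pull η h s') = (toScheme X).map h ⁻¹' eqLocus s s' := by
  ext x
  constructor
  · rintro ⟨V, q, ⟨v, rfl⟩, e⟩
    rw [map_pull, map_pull] at e
    have := hη.exists_map_eq (q ≫ h) s s' e v
    rwa [toScheme_map_comp_apply] at this
  · rintro ⟨W, g, ⟨w, hw⟩, e⟩
    obtain ⟨y, hy₁, -⟩ :=
      exists_preimage_of_isPullback (IsPullback.of_hasPullback h ((incl X).map g)) hw.symm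
    refine ⟨_, pullback.fst _ _, ⟨y, hy₁⟩, ?_⟩
    rw [map_pull, map_pull, pullback.condition, ← pull_map, ← pull_map, e]

lemma IsLocallyInverseImage.isClopen_etaleEqLocus [Finite (_root_.ConnectedComponents X)]
    {η : F ⟶ (incl X).op ⋙ G} (hη : IsLocallyInverseImage η) {U : X.Etale}
    (t t' : G.obj (op U)) : IsClopen (etaleEqLocus t t') := by
  refine ⟨⟨?_⟩, isOpen_etaleEqLocus t t'⟩
  rw [isOpen_iff_forall_mem_open]
  intro x hx
  obtain ⟨V₁, q₁, Z₁, h₁, s₁, ⟨v₁, hv₁⟩, e₁⟩ := hη.exists_eq_pull t x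
  obtain ⟨V₂, q₂, Z₂, h₂, s₂, ⟨v₂, hv₂⟩, e₂⟩ := hη.exists_eq_pull (G.map q₁.op t') v₁
  -- Both sections now come from a single finite étale scheme, so their locus is the preimage of an
  -- `eqLocus`.
  obtain ⟨Z, p₁, p₂, h, hh₁, hh₂⟩ := exists_lift_of_finiteEtale (q₂ ≫ h₁) h₂
  let q := q₂ ≫ q₁
  have et : G.map q.op t = pull η h (F.map p₁.op s₁) := by
    rw [pull_map, hh₁, ← map_pull, ← e₁]
    simp [q]
  have et' : G.map q.op t' = pull η h (F.map p₂.op s₂) := by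
    rw [pull_map, hh₂, ← e₂]
    simp [q]
  have hcl : IsClopen ((toScheme X).map q ⁻¹' etaleEqLocus t t') := by
    rw [preimage_etaleEqLocus, et, et', hη.etaleEqLocus_pull]
    exact (isClopen_eqLocus _ _).preimage ((toScheme X).map h).continuous
  -- Openness of the complement descends along `q`, because étale maps are open.
  refine ⟨(toScheme X).map q '' ((toScheme X).map q ⁻¹' etaleEqLocus t t')ᶜ, ?_,
    isOpenMap_toScheme_map q _ hcl.compl.2, ?_⟩
  · rintro _ ⟨y, hy, rfl⟩
    exact hy
  · have hx' : (toScheme X).map q v₂ = x := by rw [toScheme_map_comp_apply, hv₂, hv₁]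
    refine ⟨v₂, fun hm => hx ?_, hx'⟩
    rwa [Set.mem_preimage, hx'] at hm

lemma eq_of_eqLocus_eq_univ (hF : Presieve.IsSheaf (fetTopology X) F) {Z : FEt X}
    {s s' : F.obj (op Z)} (h : eqLocus s s' = Set.univ) : s = s' := by
  choose W g hg e using fun z => h.ge (Set.mem_univ z)
  refine (hF.isSeparated _ (ofArrows_mem_fetTopology g fun z => ⟨z, hg z⟩)).ext ?_
  rintro _ _ ⟨_, p, _, ⟨z⟩, rfl⟩
  simp [e]

lemma eq_of_etaleEqLocus_eq_univ (hG : Presieve.IsSheaf X.smallEtaleTopology G) {U : X.Etale}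
    {t t' : G.obj (op U)} (h : etaleEqLocus t t' = Set.univ) : t = t' := by
  choose W g hg e using fun z => h.ge (Set.mem_univ z)
  refine (hG.isSeparated _ (ofArrows_mem_smallEtaleTopology g fun z => ⟨z, hg z⟩)).ext ?_
  rintro _ _ ⟨_, p, _, ⟨z⟩, rfl⟩
  simp [e]

lemma pull_id (η : F ⟶ (incl X).op ⋙ G) {Z : FEt X} (s : F.obj (op Z)) :
    pull η (𝟙 Z.obj) s = η.app (op Z) s := by
  simp [pull]

lemma map_app (η : F ⟶ (incl X).op ⋙ G) {Z : FEt X} {U : X.Etale} (h : U ⟶ Z.obj)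
    (s : F.obj (op Z)) : G.map h.op (η.app (op Z) s) = pull η h s := rfl

lemma app_map (η : F ⟶ (incl X).op ⋙ G) {Y Z : FEt X} (g : Y ⟶ Z) (s : F.obj (op Z)) :
    η.app (op Y) (F.map g.op s) = pull η ((incl X).map g) s := by
  rw [← pull_id, pull_map, Category.id_comp]

lemma IsLocallyInverseImage.injective_app {η : F ⟶ (incl X).op ⋙ G}
    (hη : IsLocallyInverseImage η) (hF : Presieve.IsSheaf (fetTopology X) F) (Z : FEt X) :
    Function.Injective (η.app (op Z)) := by
  intro s s' h
  refine eq_of_eqLocus_eq_univ hF (Set.eq_univ_of_forall fun z => ?_)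
  have := hη.exists_map_eq (𝟙 Z.obj) s s' (by rw [pull_id, pull_id, h]) z
  rwa [CategoryTheory.Functor.map_id] at this

lemma IsLocallyInverseImage.exists_map_eq_app [Finite (_root_.ConnectedComponents X)]
    {η : F ⟶ (incl X).op ⋙ G} (hη : IsLocallyInverseImage η)
    (hG : Presieve.IsSheaf X.smallEtaleTopology G) {Z : FEt X} (t : G.obj (op Z.obj))
    (z : (toScheme X).obj Z.obj) :
    ∃ (Y : FEt X) (g : Y ⟶ Z) (s : F.obj (op Y)),
      z ∈ Set.range ((toScheme X).map ((incl X).map g)) ∧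
        G.map ((incl X).map g).op t = η.app (op Y) s := by
  obtain ⟨V, q, Z', h', s', ⟨v, rfl⟩, e⟩ := hη.exists_eq_pull t z
  obtain ⟨W, g, p, h, hg, hp⟩ := exists_lift_of_finiteEtale (Z₁ := Z) q h'
  let t₁ : G.obj (op W.obj) := G.map ((incl X).map g).op t
  let s₁ : F.obj (op W) := F.map p.op s'
  -- Restricting to the agreement locus remains inside the finite étale site because that locus is
  -- clopen.
  obtain ⟨Y, i, hi⟩ := exists_range_eq_of_isClopen (Z := W)
    (hη.isClopen_etaleEqLocus t₁ (η.app (op W) s₁))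
  have hv : (toScheme X).map h v ∈ etaleEqLocus t₁ (η.app (op W) s₁) := by
    refine ⟨V, h, ⟨v, rfl⟩, ?_⟩
    rw [map_app, pull_map, hp, ← e, ← hg]
    simp [t₁]
  refine ⟨Y, i ≫ g, F.map i.op s₁, ?_, ?_⟩
  · obtain ⟨y, hy⟩ := hi.ge hv
    refine ⟨y, ?_⟩
    rw [Functor.map_comp, toScheme_map_comp_apply, hy, ← toScheme_map_comp_apply, hg]
  · refine eq_of_etaleEqLocus_eq_univ hG ?_
    rw [app_map, ← map_app, Functor.map_comp, op_comp, Functor.map_comp_apply,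
      ← preimage_etaleEqLocus, ← hi]
    exact Set.preimage_range _

lemma IsLocallyInverseImage.surjective_app [Finite (_root_.ConnectedComponents X)]
    {η : F ⟶ (incl X).op ⋙ G} (hη : IsLocallyInverseImage η)
    (hF : Presieve.IsSheaf (fetTopology X) F) (hG : Presieve.IsSheaf X.smallEtaleTopology G)
    (Z : FEt X) : Function.Surjective (η.app (op Z)) := by
  intro t
  choose Y g s hz e using hη.exists_map_eq_app hG t
  have hS := ofArrows_mem_fetTopology g fun z => ⟨z, hz z⟩
  have hsh := hF _ hS
  rw [Sieve.ofArrows, ← Presieve.isSheafFor_iff_generate, Presieve.isSheafFor_arrows_iff] at hsh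
  -- Compatibility can be checked in `G`, where all the sections are restrictions of `t`.
  obtain ⟨s₀, hs₀, -⟩ := hsh s (by
    intro i j W p q hpq
    apply hη.injective_app hF
    rw [app_map, app_map, ← map_app, ← map_app, ← e, ← e, ← Functor.map_comp_apply,
      ← Functor.map_comp_apply, ← op_comp, ← op_comp, ← Functor.map_comp, ← Functor.map_comp, hpq])
  refine ⟨s₀, eq_of_etaleEqLocus_eq_univ hG (Set.eq_univ_of_forall fun z => ?_)⟩
  refine ⟨_, (incl X).map (g z), hz z, ?_⟩
  rw [map_app, ← app_map, hs₀, e]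

lemma IsLocallyInverseImage.isIso [Finite (_root_.ConnectedComponents X)]
    {η : F ⟶ (incl X).op ⋙ G} (hη : IsLocallyInverseImage η)
    (hF : Presieve.IsSheaf (fetTopology X) F) (hG : Presieve.IsSheaf X.smallEtaleTopology G) :
    IsIso η := by
  rw [NatTrans.isIso_iff_isIso_app]
  rintro ⟨Z⟩
  exact (isIso_iff_bijective _).2 ⟨hη.injective_app hF Z, hη.surjective_app hF hG Z⟩

end FiniteEtaleTopos

/-! ### The unit in terms of Kan extension and sheafification -/

namespace CategoryTheory

/-- Left adjoints are unique, so an explicit construction of the inverse image may be used. -/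
lemma Adjunction.isIso_unit_of_isIso_unit {C : Type u₁} [Category.{v₁} C] {D : Type u₂}
    [Category.{v₂} D] {L L' : C ⥤ D} {R : D ⥤ C} (adj : L ⊣ R) (adj' : L' ⊣ R)
    [IsIso adj.unit] : IsIso adj'.unit := by
  rw [← Adjunction.unit_leftAdjointUniq_hom adj adj']
  infer_instance

lemma Functor.sheafPullbackConstruction.sheafAdjunctionContinuous_unit_app_hom
    {C : Type u₁} [Category.{v₁} C] {D : Type u₂} [Category.{v₂} D] (G : C ⥤ D)
    {A : Type u} [Category.{w} A] (J : GrothendieckTopology C) (K : GrothendieckTopology D)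
    [G.IsContinuous J K] [∀ F : Cᵒᵖ ⥤ A, G.op.HasLeftKanExtension F] [HasWeakSheafify K A]
    (F : Sheaf J A) :
    ((sheafPullbackConstruction.sheafAdjunctionContinuous G A J K).unit.app F).hom =
      G.op.lanUnit.app F.obj ≫ Functor.whiskerLeft G.op (toSheafify K (G.op.lan.obj F.obj)) := by
  have h := ((G.op.lanAdjunction A).comp (sheafificationAdjunction K A)
    ).map_restrictFullyFaithful_unit_app (fullyFaithfulSheafToPresheaf J A)
      (Functor.FullyFaithful.id _) (L := sheafPullback G A J K)
      (R := G.sheafPushforwardContinuous A J K) (Iso.refl _) (Iso.refl _) F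
  refine Eq.trans h ?_
  rw [Adjunction.comp_unit_app]
  have h₁ := Functor.map_id ((Functor.whiskeringLeft _ _ A).obj G.op)
    ((presheafToSheaf K A).obj (G.op.lan.obj F.obj)).obj
  erw [h₁, Category.comp_id, Category.comp_id, Functor.lanAdjunction_unit]
  rfl

end CategoryTheory

namespace FiniteEtaleTopos

variable (X : Scheme.{u})

instance (F : (FEt X)ᵒᵖ ⥤ Type u) : (incl X).op.HasPointwiseLeftKanExtension F := by
  have (Y : (X.Etale)ᵒᵖ) : HasColimitsOfShape (CostructuredArrow (incl X).op Y) (Type u) :=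
    hasColimitsOfShape_of_essentiallySmall.{u} _ _
  infer_instance

/-- Flatness makes the colimits computing the Kan extension filtered. -/
instance : RepresentablyFlat (incl X) := flat_of_preservesFiniteLimits _

/-- The map from a presheaf on the finite étale site to the sheafification of its left Kan
extension to the étale site. -/
def toInverseImage (F : (FEt X)ᵒᵖ ⥤ Type u) :
    F ⟶ (incl X).op ⋙ sheafify X.smallEtaleTopology ((incl X).op.lan.obj F) :=
  (incl X).op.lanUnit.app F ≫ Functor.whiskerLeft (incl X).op (toSheafify X.smallEtaleTopology _)

variable {X} in
lemma pull_toInverseImage (F : (FEt X)ᵒᵖ ⥤ Type u) {U : X.Etale} {Z : FEt X} (h : U ⟶ Z.obj)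
    (s : F.obj (op Z)) :
    pull (toInverseImage X F) h s = (toSheafify X.smallEtaleTopology
      ((incl X).op.lan.obj F)).app (op U) (((incl X).op.lan.obj F).map h.op (((incl X).op.lanUnit.app F).app (op Z) s)) :=
  (NatTrans.naturality_apply (toSheafify X.smallEtaleTopology ((incl X).op.lan.obj F)) h.op _).symm

lemma isLocallyInverseImage_toInverseImage (F : (FEt X)ᵒᵖ ⥤ Type u) :
    IsLocallyInverseImage (toInverseImage X F) where
  exists_eq_pull {U} t x := by
    obtain ⟨V, q, ⟨t₀, ht₀⟩, hx⟩ := exists_mem_range_of_mem_smallEtaleTopology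
      (Presheaf.imageSieve_mem X.smallEtaleTopology
        (toSheafify X.smallEtaleTopology ((incl X).op.lan.obj F)) t) x
    obtain ⟨j, s, hs⟩ := Types.jointly_surjective_of_isColimit
      ((incl X).op.isPointwiseLeftKanExtensionLeftKanExtensionUnit F (op V)) t₀
    refine ⟨V, q, j.left.unop, j.hom.unop, s, hx, ?_⟩
    rw [← ht₀, ← hs]
    exact (pull_toInverseImage F (Z := j.left.unop) j.hom.unop s).symm
  exists_map_eq {U Z} h s s' e x := by
    rw [pull_toInverseImage, pull_toInverseImage] at e
    obtain ⟨V, q, hq, ⟨v, rfl⟩⟩ := exists_mem_range_of_mem_smallEtaleTopology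
      (Presheaf.equalizerSieve_mem X.smallEtaleTopology
        (toSheafify X.smallEtaleTopology ((incl X).op.lan.obj F)) _ _ e) x
    rw [Presheaf.equalizerSieve_apply, ← Functor.map_comp_apply, ← Functor.map_comp_apply,
      ← op_comp] at hq
    -- In a filtered colimit, equality of two elements at one index is witnessed by a single
    -- transition map, here a morphism of finite étale schemes through which `q ≫ h` factors.
    obtain ⟨j, f, hf⟩ := (Types.FilteredColimit.isColimit_eq_iff'
      ((incl X).op.isPointwiseLeftKanExtensionLeftKanExtensionUnit F (op V))
      (i := CostructuredArrow.mk (Y := op Z) (f := (q ≫ h).op)) s s').1 hq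
    refine ⟨j.left.unop, f.left.unop, ?_, hf⟩
    have hw : j.hom.unop ≫ (incl X).map f.left.unop = q ≫ h :=
      congrArg Quiver.Hom.unop (CostructuredArrow.w f)
    refine ⟨(toScheme X).map j.hom.unop v, ?_⟩
    rw [← toScheme_map_comp_apply, hw, toScheme_map_comp_apply]

lemma isIso_unit_rhoAdjunction [Finite (_root_.ConnectedComponents X)] :
    IsIso (rhoAdjunction X).unit := by
  let adj := Functor.sheafPullbackConstruction.sheafAdjunctionContinuous (incl X) (Type u)
    (fetTopology X) X.smallEtaleTopology
  have hadj : IsIso adj.unit := by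
    rw [NatTrans.isIso_iff_isIso_app]
    intro F
    have h : (adj.unit.app F).hom = toInverseImage X F.obj :=
      Functor.sheafPullbackConstruction.sheafAdjunctionContinuous_unit_app_hom _ _ _ F
    have h' : IsIso (toInverseImage X F.obj) :=
      (isLocallyInverseImage_toInverseImage X F.obj).isIso
        ((isSheaf_iff_isSheaf_of_type _ _).1 F.2)
        ((isSheaf_iff_isSheaf_of_type _ _).1 ((presheafToSheaf _ _).obj _).2)
    have : IsIso ((sheafToPresheaf _ _).map (adj.unit.app F)) := by
      change IsIso (adj.unit.app F).hom
      rwa [h]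
    exact isIso_of_reflects_iso _ (sheafToPresheaf _ _)
  exact adj.isIso_unit_of_isIso_unit (rhoAdjunction X)

end FiniteEtaleTopos

end

theorem proposition8p10 (X : Scheme.{u}) [CompactSpace X] [QuasiSeparatedSpace X]
    [Finite (_root_.ConnectedComponents X)] :
    IsIso (FiniteEtaleTopos.rhoAdjunction X).unit ∧
      (FiniteEtaleTopos.rhoPullback X).Full ∧ (FiniteEtaleTopos.rhoPullback X).Faithful := by
  have h := FiniteEtaleTopos.isIso_unit_rhoAdjunction X
  have e := (FiniteEtaleTopos.rhoAdjunction X).fullyFaithfulLOfIsIsoUnit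
  exact ⟨h, e.full, e.faithful⟩
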